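/- For extended real numbers $a<b$ let $S_{a,b}=\{z\in\mathbb C : a<\operatorname{Im} z<b\}$. Call $f:S_{a,b}\to\mathbb C$ positive definite on $S_{a,b}$ if for every $n\in\mathbb N$ and all $z_1,\dots,z_n\in\mathbb C$ with $z_k-\overline{z_l}\in S_{a,b}$ for all $k,l$, one has $$\sum_{k,l=1}^n f(z_k-\overline{z_l})\,\xi_k\,\overline{\xi_l}\ \ge\ 0\qquad\text{for all }\xi_1,\dots,\xi_n\in\mathbb C$$ (that is, the sum is real and nonnegative). A nonnegative Borel measure $\mu$ on $\mathbb R$ is exponentially finite with respect to $(a,b)$ if $\int_{\mathbb R}e^{-yt}\,d\mu(t)<\infty$ for every real $y\in(a,b)$. Theorem. Let $-\infty\le a<b\le+\infty$ and let $f:S_{a,b}\to\mathbb C$ be positive definite on $S_{a,b}$. Suppose that $f$ is holomorphic on some open set $\Omega\subseteq S_{a,b}$ containing the imaginary segment $\{iy : y\in\mathbb R,\ a<y<b\}$. Then $f$ is holomorphic on all of $S_{a,b}$, and there is a unique nonnegative Borel measure $\mu$ on $\mathbb R$ that is exponentially finite with respect to $(a,b)$ and of which $f$ is the Fourier–Laplace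 transform on $S_{a,b}$, i.e. $$f(z)=\int_{-\infty}^{+\infty}e^{izt}\,d\mu(t)\qquad\text{for all }z\in S_{a,b},$$ the integrals converging absolutely. -/

import Mathlib

open MeasureTheory
open scoped ComplexConjugate ComplexOrder

/-- The open horizontal strip `S_{a,b} = {z : a < Im z < b}`, with `a`, `b` extended reals. -/
def horizontalStrip (a b : EReal) : Set ℂ :=
  {z : ℂ | a < (z.im : EReal) ∧ (z.im : EReal) < b}

/-- The open interval `(a, b)` of real numbers, with extended real endpoints. -/
def realInterval (a b : EReal) : Set ℝ :=
  {y : ℝ | a < (y : EReal) ∧ (y : EReal) < b}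

/-- The imaginary segment `{iy : a < y < b}`. -/
def imaginarySegment (a b : EReal) : Set ℂ :=
  (fun y : ℝ => Complex.I * (y : ℂ)) '' realInterval a b

/-- `f` is positive definite in `S`: for all finite families `z` of complex numbers (not
necessarily in `S`) all of whose codifferences `z k - conj (z l)` lie in `S`, the form with matrix
`f (z k - conj (z l))` takes only real nonnegative values. Only values of `f` on `S` matter.
(The order on `ℂ` is such that `0 ≤ w` means that `w` is real and nonnegative.) -/
def IsPositiveDefiniteIn (f : ℂ → ℂ) (S : Set ℂ) : Prop :=
  ∀ (n : ℕ) (z : Fin n → ℂ), (∀ k l, z k - conj (z l) ∈ S) →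
    ∀ ξ : Fin n → ℂ, 0 ≤ ∑ k, ∑ l, f (z k - conj (z l)) * ξ k * conj (ξ l)

/-- The nonnegative Borel measure `μ` on `ℝ` is exponentially finite with respect to `I`. -/
def IsExponentiallyFinite (μ : Measure ℝ) (I : Set ℝ) : Prop :=
  ∀ y ∈ I, ∫⁻ t, ENNReal.ofReal (Real.exp (-(y * t))) ∂μ < ⊤

/-- On `S`, the function `f` is the Fourier-Laplace transform of `μ`: for each `z` in `S` the
integral of `exp (i z t)` against `μ` converges absolutely and equals `f z`. -/
def IsFourierLaplaceTransformOn (f : ℂ → ℂ) (μ : Measure ℝ) (S : Set ℂ) : Prop :=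
  ∀ z ∈ S, Integrable (fun t : ℝ => Complex.exp (Complex.I * z * (t : ℂ))) μ ∧
    f z = ∫ t : ℝ, Complex.exp (Complex.I * z * (t : ℂ)) ∂μ

/-! On each line Im z = y, f is a positive definite function of Re z, continuous at iy because iy
lies in Ω. Bochner's theorem (`exists_charFun_eq`) makes it the characteristic function of a finite
measure ν_y.

Off Ω no regularity of f is given, but f is holomorphic on a disc about iy. Cauchy's estimates there
control the even moments of ν_y and give exponential moments up to the radius of the disc
(`integrable_exp_mul_of_charFun_eq`). The Fourier-Laplace transform of ν_y is thus holomorphic in a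
strip, and the identity theorem yields ν_y' = exp(-(y' - y)t) ν_y for y' near y
(`expWeight_eq_of_charFun_eq`). So exp(yt) ν_y is locally constant in y, hence constant on the
connected interval (a, b); this constant is μ. Holomorphy of f follows from the integral formula,
and uniqueness of μ from that of characteristic functions on a single line.

Bochner's theorem is proved by Gaussian regularization: the regularized functions are, up to
constants, characteristic functions of explicit finite measures, and tightness allows passage to the
limit. -/

open Filter Topology ProbabilityTheory Metric
open scoped NNReal ENNReal

/-! ### Positive definite functions on the real line -/

/-- A function on the real line is positive definite if all the matrices `g (x k - x l)` are
positive semidefinite. -/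
def IsPositiveDefiniteOnReal (g : ℝ → ℂ) : Prop :=
  ∀ (n : ℕ) (x : Fin n → ℝ) (ξ : Fin n → ℂ),
    0 ≤ ∑ k, ∑ l, g (x k - x l) * ξ k * conj (ξ l)

namespace IsPositiveDefiniteOnReal

variable {g : ℝ → ℂ}

lemma map_zero_nonneg (hg : IsPositiveDefiniteOnReal g) : 0 ≤ g 0 := by
  simpa using hg 1 (fun _ => 0) (fun _ => 1)

lemma two_point (hg : IsPositiveDefiniteOnReal g) (x : ℝ) (a b : ℂ) :
    0 ≤ g 0 * a * conj a + g x * a * conj b + (g (-x) * b * conj a + g 0 * b * conj b) := by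
  simpa [Fin.sum_univ_two] using hg 2 ![x, 0] ![a, b]

lemma map_neg_eq_conj (hg : IsPositiveDefiniteOnReal g) (x : ℝ) : g (-x) = conj (g x) := by
  have h0 := (Complex.nonneg_iff.1 hg.map_zero_nonneg).2
  have h1 := (Complex.nonneg_iff.1 (hg.two_point x 1 1)).2
  have h2 := (Complex.nonneg_iff.1 (hg.two_point x Complex.I 1)).2
  simp at h1 h2
  apply Complex.ext <;> simp <;> linarith

lemma norm_map_le (hg : IsPositiveDefiniteOnReal g) (x : ℝ) : ‖g x‖ ≤ (g 0).re := by
  have h0 := (Complex.nonneg_iff.1 hg.map_zero_nonneg)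
  by_cases hx : g x = 0
  · simpa [hx] using h0.1
  have hn : (‖g x‖ : ℂ) ≠ 0 := by simpa using hx
  -- The phase turns both cross terms into -‖g x‖, so the form equals 2 g(0) - 2‖g x‖.
  have h := hg.two_point x (-(conj (g x) / ‖g x‖)) 1
  have e1 : g x * (-(conj (g x) / ‖g x‖)) = -‖g x‖ := by
    rw [mul_neg, ← mul_div_assoc, Complex.mul_conj', sq, mul_div_assoc, div_self hn, mul_one]
  have e2 : g (-x) * (-(g x / ‖g x‖)) = -‖g x‖ := by
    rw [hg.map_neg_eq_conj, mul_neg, ← mul_div_assoc, Complex.conj_mul', sq, mul_div_assoc, div_self hn,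
      mul_one]
  have e3 : (-(conj (g x) / ‖g x‖)) * (-(g x / ‖g x‖)) = 1 := by
    rw [neg_mul_neg, div_mul_div_comm, Complex.conj_mul', sq, div_self (mul_ne_zero hn hn)]
  simp only [mul_one, map_one, map_neg, map_div₀, Complex.conj_conj, Complex.conj_ofReal] at h
  rw [mul_assoc, e3, e1, e2] at h
  have := (Complex.nonneg_iff.1 h).1
  simp at this
  linarith

/-- Test the form at x, y, 0 with coefficients 1, -1, -sD, where D = g x - g y: the cross terms
contribute -2s‖D‖². The summand 1 in s⁻¹ = g(0) + 1 avoids dividing by g(0), which may vanish. -/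
lemma norm_sub_sq_le (hg : IsPositiveDefiniteOnReal g) (x y : ℝ) :
    ‖g x - g y‖ ^ 2 ≤ 2 * ((g 0).re - (g (x - y)).re) * ((g 0).re + 1) := by
  have h0 := Complex.nonneg_iff.1 hg.map_zero_nonneg
  set s : ℝ := ((g 0).re + 1)⁻¹ with hs
  set D := g x - g y with hD
  have h := (Complex.nonneg_iff.1 (hg 3 ![x, y, 0] ![1, -1, -(s * D)])).1
  have hyx : g (y - x) = conj (g (x - y)) := by rw [← hg.map_neg_eq_conj, neg_sub]
  simp [Fin.sum_univ_three, hyx, hg.map_neg_eq_conj] at h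
  have hn : ‖D‖ ^ 2 = D.re ^ 2 + D.im ^ 2 := by
    rw [Complex.sq_norm, Complex.normSq_apply]; ring
  have hDr : D.re = (g x).re - (g y).re := by simp [hD]
  have hDi : D.im = (g x).im - (g y).im := by simp [hD]
  have key : 0 ≤ 2 * ((g 0).re - (g (x - y)).re) - 2 * s * ‖D‖ ^ 2
      + s ^ 2 * ‖D‖ ^ 2 * (g 0).re := by
    rw [hn]
    rw [← h0.2] at h
    refine h.trans_eq ?_
    have hDr' : (g x).re = D.re + (g y).re := by rw [hDr]; ring
    have hDi' : (g x).im = D.im + (g y).im := by rw [hDi]; ring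
    rw [hDr', hDi']; ring
  have hpos : 0 < (g 0).re + 1 := by linarith [h0.1]
  have hspos : 0 < s := by positivity
  have hsm : s * ((g 0).re + 1) = 1 := inv_mul_cancel₀ hpos.ne'
  have h1 : s * ‖D‖ ^ 2 ≤ 2 * ((g 0).re - (g (x - y)).re) := by
    have : s ^ 2 * ‖D‖ ^ 2 * (g 0).re = s * ‖D‖ ^ 2 * (s * (g 0).re) := by ring
    have h2 : s * (g 0).re ≤ 1 := by nlinarith
    have h3 : 0 ≤ s * ‖D‖ ^ 2 := by positivity
    nlinarith
  calc ‖D‖ ^ 2 = (s * ‖D‖ ^ 2) * ((g 0).re + 1) := by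
        rw [mul_right_comm, hsm, one_mul]
    _ ≤ _ := by gcongr

lemma continuous_of_continuousAt (hg : IsPositiveDefiniteOnReal g) (hc : ContinuousAt g 0) :
    Continuous g := by
  refine continuous_iff_continuousAt.2 fun y => ?_
  have h1 : Tendsto (fun x : ℝ => x - y) (𝓝 y) (𝓝 0) := by
    have : Continuous (fun x : ℝ => x - y) := by fun_prop
    simpa using this.tendsto y
  have h2 : Tendsto (fun x => (g (x - y)).re) (𝓝 y) (𝓝 (g 0).re) :=
    (Complex.continuous_re.tendsto _).comp (hc.tendsto.comp h1)
  have h3 : Tendsto (fun x => 2 * ((g 0).re - (g (x - y)).re) * ((g 0).re + 1)) (𝓝 y) (𝓝 0) := by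
    simpa using (((tendsto_const_nhds (x := (g 0).re)).sub h2).const_mul 2).mul_const
      ((g 0).re + 1)
  have h4 : Tendsto (fun x => ‖g x - g y‖ ^ 2) (𝓝 y) (𝓝 0) :=
    squeeze_zero (fun _ => by positivity) (fun x => hg.norm_sub_sq_le x y) h3
  rw [ContinuousAt, tendsto_iff_norm_sub_tendsto_zero]
  simpa using h4.sqrt

/-- Averaging the positivity of the quadratic forms over independent random points. -/
lemma integral_prod_nonneg (hg : IsPositiveDefiniteOnReal g) (hc : Continuous g) (ν : Measure ℝ)
    [IsProbabilityMeasure ν] (t : ℝ) :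
    0 ≤ ∫ p : ℝ × ℝ, g (p.1 - p.2) * Complex.exp (-(t * (p.1 - p.2) : ℝ) * Complex.I)
      ∂(ν.prod ν) := by
  set φ : ℝ → ℂ := fun u => g u * Complex.exp (-(t * u : ℝ) * Complex.I) with hφ
  have hφc : Continuous φ := by fun_prop
  have hφ0 : φ 0 = g 0 := by simp [hφ]
  have hφb : ∀ u, ‖φ u‖ ≤ (g 0).re := fun u => by
    rw [hφ, norm_mul, ← Complex.ofReal_neg, Complex.norm_exp_ofReal_mul_I, mul_one]
    exact hg.norm_map_le u
  set W := ∫ p : ℝ × ℝ, φ (p.1 - p.2) ∂(ν.prod ν) with hW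
  -- For n independent points of law ν, the expected form has n diagonal terms g(0) and n(n - 1)
  -- off-diagonal terms W. Dividing by n² and letting n tend to infinity isolates W.
  have key : ∀ n : ℕ, 0 ≤ (n : ℂ) * g 0 + (n : ℂ) * (n - 1) * W := by
    intro n
    have hpos : ∀ x : Fin n → ℝ, 0 ≤ ∑ k, ∑ l, φ (x k - x l) := fun x => by
      refine (hg n x (fun k => Complex.exp (-(t * x k : ℝ) * Complex.I))).trans_eq ?_
      refine Finset.sum_congr rfl fun k _ => Finset.sum_congr rfl fun l _ => ?_
      rw [← Complex.exp_conj, mul_assoc, ← Complex.exp_add, hφ]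
      congr 2
      simp
      ring
    have hint : 0 ≤ ∫ x : Fin n → ℝ, ∑ k, ∑ l, φ (x k - x l) ∂(Measure.pi fun _ => ν) :=
      integral_nonneg hpos
    have hI : ∀ k l : Fin n,
        Integrable (fun x : Fin n → ℝ => φ (x k - x l)) (Measure.pi fun _ => ν) := fun k l =>
      Integrable.of_bound (by fun_prop) (g 0).re (.of_forall fun _ => hφb _)
    rw [integral_finsetSum _ fun k _ => integrable_finsetSum _ fun l _ => hI k l] at hint
    have hkl : ∀ k l : Fin n, ∫ x : Fin n → ℝ, φ (x k - x l) ∂(Measure.pi fun _ => ν)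
        = if k = l then g 0 else W := by
      intro k l
      split_ifs with h
      · simp [h, hφ0]
      · have hind : iIndepFun (fun (i : Fin n) (x : Fin n → ℝ) => x i)
            (Measure.pi fun _ : Fin n => ν) :=
          iIndepFun_pi (X := fun _ => id) (fun i => aemeasurable_id)
        have h2 := (indepFun_iff_map_prod_eq_prod_map_map
          (measurable_pi_apply k).aemeasurable (measurable_pi_apply l).aemeasurable).1
          (hind.indepFun h)
        have hm : ∀ i : Fin n, (Measure.pi fun _ : Fin n => ν).map (fun x => x i) = ν :=
          fun i => (measurePreserving_eval (fun _ : Fin n => ν) i).map_eq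
        rw [hm, hm] at h2
        rw [hW, ← h2, integral_map (by fun_prop) (by fun_prop)]
    have hsum : ∀ k : Fin n, ∫ x : Fin n → ℝ, ∑ l, φ (x k - x l) ∂(Measure.pi fun _ => ν)
        = g 0 + (n - 1) * W := by
      intro k
      rw [integral_finsetSum _ fun l _ => hI k l]
      simp_rw [hkl]
      have : ∀ l, (if k = l then g 0 else W) = (if k = l then g 0 - W else 0) + W := by
        intro l; split_ifs <;> ring
      simp_rw [this]
      rw [Finset.sum_add_distrib, Finset.sum_ite_eq]
      simp
      ring
    simp_rw [hsum] at hint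
    simp at hint
    convert hint using 1
    ring
  have hlim : Tendsto (fun n : ℕ => (1 / (n + 1 : ℝ) : ℝ) * (g 0).re + (1 - 1 / (n + 1 : ℝ)) * W.re)
      atTop (𝓝 (0 * (g 0).re + (1 - 0) * W.re)) :=
    (tendsto_one_div_add_atTop_nhds_zero_nat.mul_const _).add
      ((tendsto_const_nhds.sub tendsto_one_div_add_atTop_nhds_zero_nat).mul_const _)
  have hre : 0 ≤ W.re := by
    have := ge_of_tendsto hlim (b := 0) (.of_forall fun n => ?_)
    · simpa using this
    · have h := (Complex.nonneg_iff.1 (key (n + 1))).1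
      simp at h
      have hn : (0 : ℝ) < n + 1 := by positivity
      have : (1 / (n + 1 : ℝ) : ℝ) * (g 0).re + (1 - 1 / (n + 1 : ℝ)) * W.re
          = ((n + 1) * (g 0).re + (n + 1) * n * W.re) / (n + 1) ^ 2 := by
        field_simp
        ring
      rw [this]
      positivity
  have him : 0 = W.im := by
    have h := (Complex.nonneg_iff.1 (key 2)).2
    have h0 := (Complex.nonneg_iff.1 hg.map_zero_nonneg).2
    have e : (2 : ℂ) - 1 = 1 := by norm_num
    simp [← h0, e] at h
    linarith
  exact Complex.nonneg_iff.2 ⟨hre, him⟩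

end IsPositiveDefiniteOnReal

/-! ### Gaussian regularization and Bochner's theorem -/

/-- The Gaussian average of `g` that occurs in the regularization of a positive definite function
by means of Gaussian measures of variance `v`. -/
noncomputable def gaussianRegularization (g : ℝ → ℂ) (v : ℝ≥0) (x : ℝ) : ℂ :=
  ∫ s, g (x + √(v⁻¹ : ℝ≥0) * s) * Real.exp (-(x + √(v⁻¹ : ℝ≥0) * s) ^ 2 / (2 * (2 * v)))
    ∂(gaussianReal 0 1)

lemma gaussianRegularization_eq_integral (g : ℝ → ℂ) (hc : Continuous g) (v : ℝ≥0) (x : ℝ) :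
    gaussianRegularization g v x
      = ∫ u, g u * Real.exp (-u ^ 2 / (2 * (2 * v))) ∂(gaussianReal x v⁻¹) := by
  have h : gaussianReal x v⁻¹ = (gaussianReal 0 1).map (fun s => x + √(v⁻¹ : ℝ≥0) * s) := by
    have := Measure.map_map (μ := gaussianReal 0 1) (f := fun s : ℝ => √(v⁻¹ : ℝ≥0) * s)
      (g := fun s : ℝ => x + s) (by fun_prop) (by fun_prop)
    rw [gaussianReal_map_const_mul, gaussianReal_map_const_add] at this
    simp only [Function.comp_def] at this
    rw [← this]
    congr 1
    · simp
    · ext; simp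
  rw [h, integral_map (by fun_prop) (by fun_prop), gaussianRegularization]

namespace IsPositiveDefiniteOnReal

variable {g : ℝ → ℂ}

/-- As v tends to infinity, the Gaussian of variance 1/v concentrates at x and the exponential
factor tends to 1; g(0) dominates throughout. -/
lemma tendsto_gaussianRegularization (hg : IsPositiveDefiniteOnReal g) (hc : Continuous g)
    (x : ℝ) :
    Tendsto (fun n : ℕ => gaussianRegularization g (n + 1) x) atTop (𝓝 (g x)) := by
  have h1 : Tendsto (fun n : ℕ => √(((n : ℝ≥0) + 1)⁻¹ : ℝ≥0)) atTop (𝓝 0) := by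
    have : Tendsto (fun n : ℕ => 1 / ((n : ℝ) + 1)) atTop (𝓝 0) :=
      tendsto_one_div_add_atTop_nhds_zero_nat
    simpa using this.sqrt
  have h2 : Tendsto (fun n : ℕ => (1 / ((n : ℝ) + 1))) atTop (𝓝 0) :=
      tendsto_one_div_add_atTop_nhds_zero_nat
  have : g x = ∫ s, g x ∂(gaussianReal 0 1) := by simp
  rw [this]
  refine tendsto_integral_of_dominated_convergence (fun _ => (g 0).re)
    (fun n => by fun_prop) (integrable_const _) (fun n => .of_forall fun s => ?_)
    (.of_forall fun s => ?_)
  · rw [norm_mul, Complex.norm_real, Real.norm_eq_abs, Real.abs_exp]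
    have hle : Real.exp (-(x + √(((n + 1 : ℝ≥0))⁻¹ : ℝ≥0) * s) ^ 2 / (2 * (2 * (n + 1 : ℝ≥0))))
        ≤ 1 := by
      rw [Real.exp_le_one_iff, neg_div]
      exact neg_nonpos.2 (by positivity)
    calc _ ≤ (g 0).re * 1 := mul_le_mul (hg.norm_map_le _) hle (by positivity)
          ((norm_nonneg _).trans (hg.norm_map_le 0))
      _ = _ := mul_one _
  · have h3 : Tendsto (fun n : ℕ => x + √(((n : ℝ≥0) + 1)⁻¹ : ℝ≥0) * s) atTop (𝓝 x) := by
      simpa using (h1.mul_const s).const_add x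
    have h4 : Tendsto (fun n : ℕ => -(x + √(((n : ℝ≥0) + 1)⁻¹ : ℝ≥0) * s) ^ 2
        / (2 * (2 * ((n : ℝ≥0) + 1 : ℝ≥0)))) atTop (𝓝 0) := by
      have := (h3.pow 2).neg.mul (h2.mul_const (1 / 4))
      simp only [zero_mul, mul_zero] at this
      refine this.congr fun n => ?_
      push_cast
      field_simp
      ring
    have h5 := ((hc.tendsto x).comp h3).mul
      ((Complex.continuous_ofReal.tendsto _).comp ((Real.continuous_exp.tendsto 0).comp h4))
    simpa using h5

/-- The measure has density h ≥ 0 against N(0, v), with h the Fourier transform of g dN(0, 2v).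
Positivity holds because N(0, 2v) is the law of a difference of two independent N(0, v) variables.
Fubini then produces a product of two Gaussians in u, which is regrouped. -/
lemma exists_charFun_eq_mul_gaussianRegularization (hg : IsPositiveDefiniteOnReal g)
    (hc : Continuous g) {v : ℝ≥0} (hv : v ≠ 0) :
    ∃ μ : Measure ℝ, IsFiniteMeasure μ ∧ ∃ c : ℝ, 0 < c ∧
      ∀ x, charFun μ x = c * gaussianRegularization g v x := by
  set h : ℝ → ℂ := fun t =>
    ∫ u, g u * Complex.exp (-(t * u : ℝ) * Complex.I) ∂(gaussianReal 0 (2 * v)) with hh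
  have hK : ∀ t u : ℝ, ‖g u * Complex.exp (-(t * u : ℝ) * Complex.I)‖ ≤ (g 0).re := fun t u => by
    rw [norm_mul, ← Complex.ofReal_neg, Complex.norm_exp_ofReal_mul_I, mul_one]
    exact hg.norm_map_le u
  have hpos : ∀ t, 0 ≤ h t := fun t => by
    have := hg.integral_prod_nonneg hc (gaussianReal 0 v) t
    convert this using 1
    have e : gaussianReal 0 (2 * v) = ((gaussianReal 0 v).prod (gaussianReal 0 v)).map
        (fun p : ℝ × ℝ => p.1 - p.2) := by
      have e1 : gaussianReal 0 v = (gaussianReal 0 v).map (fun x => -x) := by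
        rw [gaussianReal_map_neg, neg_zero]
      have e2 := Measure.map_prod_map (gaussianReal 0 v) (gaussianReal 0 v)
        (f := id) (g := fun x : ℝ => -x) measurable_id measurable_neg
      rw [Measure.map_id, ← e1] at e2
      have e3 := gaussianReal_conv_gaussianReal (m₁ := 0) (m₂ := 0) (v₁ := v) (v₂ := v)
      rw [Measure.conv, e2, Measure.map_map (by fun_prop) (by fun_prop), add_zero, ← two_mul]
        at e3
      rw [← e3]
      rfl
    rw [hh]
    dsimp only
    rw [e, integral_map (by fun_prop) (by fun_prop)]
  have hcont : Continuous h :=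
    continuous_of_dominated (fun t => by fun_prop)
      (fun t => .of_forall (hK t)) (integrable_const _) (.of_forall fun u => by fun_prop)
  have hre : ∀ t, ((h t).re : ℂ) = h t := fun t =>
    (Complex.ext rfl (by simpa using (Complex.nonneg_iff.1 (hpos t)).2))
  have hle : ∀ t, ‖h t‖ ≤ (g 0).re := fun t => by
    have := norm_integral_le_of_norm_le_const (μ := gaussianReal 0 (2 * v)) (.of_forall (hK t))
    rwa [probReal_univ, mul_one] at this
  have hint : Integrable (fun t => (h t).re) (gaussianReal 0 v) :=
    Integrable.of_bound (by fun_prop) (g 0).re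
      (.of_forall fun t => (Complex.abs_re_le_norm _).trans (hle t))
  refine ⟨(gaussianReal 0 v).withDensity (fun t => ENNReal.ofReal (h t).re),
    isFiniteMeasure_withDensity_ofReal hint.2,
    -- Ratio of the normalizing constants of N(0, 2v) and N(x, 1/v).
    (√(2 * Real.pi * (2 * v : ℝ≥0)))⁻¹ * √(2 * Real.pi * (v⁻¹ : ℝ≥0)), ?_, fun x => ?_⟩
  · have : 0 < v := pos_iff_ne_zero.2 hv
    have := Real.pi_pos
    positivity
  have s1 : charFun ((gaussianReal 0 v).withDensity (fun t => ENNReal.ofReal (h t).re)) x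
      = ∫ t, h t * Complex.exp (x * t * Complex.I) ∂(gaussianReal 0 v) := by
    rw [charFun_apply_real, integral_withDensity_eq_integral_toReal_smul (by fun_prop)
      (.of_forall fun _ => ENNReal.ofReal_lt_top)]
    refine integral_congr_ae (.of_forall fun t => ?_)
    dsimp only
    rw [ENNReal.toReal_ofReal (Complex.nonneg_iff.1 (hpos t)).1, Complex.real_smul, hre]
  have s2 : ∫ t, h t * Complex.exp (x * t * Complex.I) ∂(gaussianReal 0 v)
      = ∫ u, g u * Complex.exp (-(v * (x - u) ^ 2 / 2)) ∂(gaussianReal 0 (2 * v)) := by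
    have : ∀ t : ℝ, h t * Complex.exp (x * t * Complex.I) = ∫ u : ℝ,
        g u * Complex.exp (-(t * u : ℝ) * Complex.I) * Complex.exp (x * t * Complex.I)
        ∂(gaussianReal 0 (2 * v)) := fun t => by
      rw [integral_mul_const]
    simp_rw [this]
    rw [integral_integral_swap]
    · refine integral_congr_ae (.of_forall fun u => ?_)
      dsimp only
      have := charFun_gaussianReal (μ := 0) (v := v) (x - u)
      rw [charFun_apply_real] at this
      have e : Complex.exp (-(v * (x - u) ^ 2 / 2))
          = ∫ t : ℝ, Complex.exp ((x - u : ℝ) * t * Complex.I) ∂(gaussianReal 0 v) := by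
        rw [this]; simp
      rw [e, ← integral_const_mul]
      refine integral_congr_ae (.of_forall fun t => ?_)
      dsimp only
      rw [mul_assoc, ← Complex.exp_add]
      congr 2
      push_cast
      ring
    · refine Integrable.of_bound (by fun_prop) (g 0).re (.of_forall fun p => ?_)
      have : ‖Complex.exp (x * p.1 * Complex.I)‖ = 1 := by
        rw [← Complex.ofReal_mul, Complex.norm_exp_ofReal_mul_I]
      simp only [Function.uncurry]
      rw [norm_mul, this, mul_one]
      exact hK _ _
  have hv2 : (2 * v : ℝ≥0) ≠ 0 := mul_ne_zero two_ne_zero hv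
  have hvi : v⁻¹ ≠ 0 := inv_ne_zero hv
  have hvr : (v : ℝ) ≠ 0 := by exact_mod_cast hv
  rw [s1, s2, gaussianRegularization_eq_integral g hc, integral_gaussianReal_eq_integral_smul hv2,
    integral_gaussianReal_eq_integral_smul hvi, ← integral_const_mul]
  refine integral_congr_ae (.of_forall fun u => ?_)
  have hs : √(2 * Real.pi * (v⁻¹ : ℝ≥0)) ≠ 0 := by
    have : 0 < v := pos_iff_ne_zero.2 hv
    have := Real.pi_pos
    positivity
  have hpdf : gaussianPDFReal 0 (2 * v) u * Real.exp (-(v * (x - u) ^ 2 / 2))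
      = ((√(2 * Real.pi * (2 * v : ℝ≥0)))⁻¹ * √(2 * Real.pi * (v⁻¹ : ℝ≥0)))
        * (gaussianPDFReal x v⁻¹ u * Real.exp (-u ^ 2 / (2 * (2 * v)))) := by
    have e1 : -(v * (x - u) ^ 2 / 2) = -(u - x) ^ 2 / (2 * (v⁻¹ : ℝ≥0)) := by
      push_cast
      field_simp
      ring
    rw [gaussianPDFReal, gaussianPDFReal, e1, sub_zero]
    push_cast
    field_simp
  have hpdf' := congrArg (fun r : ℝ => (r : ℂ)) hpdf
  simp only [Complex.ofReal_mul, Complex.ofReal_exp] at hpdf'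
  simp only [Complex.real_smul]
  have e2 : Complex.exp (-(v * (x - u) ^ 2 / 2)) = Complex.exp ((-(v * (x - u) ^ 2 / 2) : ℝ)) := by
    push_cast; rfl
  rw [e2, mul_left_comm, hpdf', Complex.ofReal_mul, Complex.ofReal_exp]
  ring

lemma exists_probabilityMeasure_tendsto_charFun (hg : IsPositiveDefiniteOnReal g)
    (hc : Continuous g) (h0 : g 0 ≠ 0) :
    ∃ P : ℕ → ProbabilityMeasure ℝ,
      ∀ x, Tendsto (fun n => charFun (P n : Measure ℝ) x) atTop (𝓝 (g x / g 0)) := by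
  choose μ hμ c hcpos hμc using fun n : ℕ =>
    hg.exists_charFun_eq_mul_gaussianRegularization hc (v := n + 1) (by positivity)
  -- Beyond N the masses are nonzero, so the measures can be normalized.
  obtain ⟨N, hN⟩ := eventually_atTop.1 ((hg.tendsto_gaussianRegularization hc 0).eventually_ne h0)
  have hmass : ∀ n, ((μ n).real Set.univ : ℂ) = c n * gaussianRegularization g (n + 1) 0 :=
    fun n => by rw [← hμc, charFun_zero]
  have hne : ∀ n, NeZero (μ (n + N)) := fun n => ⟨fun h => by
    have := hmass (n + N)
    rw [h] at this
    simp [(hcpos (n + N)).ne'] at this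
    exact hN (n + N) (Nat.le_add_left _ _) (by exact_mod_cast this)⟩
  refine ⟨fun n => ⟨(μ (n + N) Set.univ)⁻¹ • μ (n + N), inferInstance⟩, fun x => ?_⟩
  have hlim := ((hg.tendsto_gaussianRegularization hc x).div
    (hg.tendsto_gaussianRegularization hc 0) h0).comp (tendsto_add_atTop_nat N)
  refine hlim.congr fun n => ?_
  have hcn : (c (n + N) : ℂ) ≠ 0 := by exact_mod_cast (hcpos _).ne'
  simp only [Function.comp, ProbabilityMeasure.coe_mk, Pi.div_apply]
  rw [charFun_apply, integral_smul_measure, ← charFun_apply, hμc, Complex.real_smul,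
    ENNReal.toReal_inv, Complex.ofReal_inv]
  have := hmass (n + N)
  rw [Measure.real] at this
  rw [this, mul_inv]
  field_simp

/-- **Bochner's theorem** on the real line: a positive definite function that is continuous at the
origin is the characteristic function of a finite measure. -/
theorem exists_charFun_eq (hg : IsPositiveDefiniteOnReal g) (hc : ContinuousAt g 0) :
    ∃ μ : Measure ℝ, IsFiniteMeasure μ ∧ ∀ x, charFun μ x = g x := by
  by_cases h0 : g 0 = 0
  · refine ⟨0, inferInstance, fun x => ?_⟩
    have := hg.norm_map_le x
    rw [h0] at this
    simpa using (norm_le_zero_iff.1 this).symm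
  have hcont := hg.continuous_of_continuousAt hc
  obtain ⟨P, hP⟩ := hg.exists_probabilityMeasure_tendsto_charFun hcont h0
  -- Convergence of characteristic functions to a continuous limit forces tightness. Prokhorov's
  -- theorem then gives a weak limit along an ultrafilter, which replaces a subsequence.
  have htight := isTightMeasureSet_of_tendsto_charFun (μ := fun n => (P n : Measure ℝ))
    (f := fun x => g x / g 0) (by fun_prop) hP
  have hcomp : IsCompact (closure (Set.range P)) := by
    apply isCompact_closure_of_isTightMeasureSet
    convert htight using 1
    ext μ
    simp
  obtain ⟨μ, -, hμ⟩ := hcomp.ultrafilter_le_nhds ((hyperfilter ℕ).map P)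
    (le_principal_iff.2 (Filter.mem_map.2 (univ_mem'
      fun n => subset_closure (Set.mem_range_self n))))
  have hμ' : Tendsto P (hyperfilter ℕ) (𝓝 μ) := hμ
  rw [ProbabilityMeasure.tendsto_iff_forall_integral_rclike_tendsto ℂ] at hμ'
  have hchar : ∀ x, charFun (μ : Measure ℝ) x = g x / g 0 := fun x => by
    refine tendsto_nhds_unique (?_ : Tendsto (fun n => charFun (P n : Measure ℝ) x)
      (hyperfilter ℕ : Filter ℕ) _) ((hP x).mono_left Nat.hyperfilter_le_atTop)
    simp_rw [charFun_eq_integral_innerProbChar]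
    exact hμ' _
  have h0' := Complex.nonneg_iff.1 hg.map_zero_nonneg
  have h0re : ((g 0).re : ℂ) = g 0 := Complex.ext rfl (by simpa using h0'.2)
  refine ⟨ENNReal.ofReal (g 0).re • (μ : Measure ℝ), Measure.smul_finite _ ENNReal.ofReal_ne_top,
    fun x => ?_⟩
  rw [charFun_apply, integral_smul_measure, ← charFun_apply, hchar, ENNReal.toReal_ofReal h0'.1,
    Complex.real_smul, h0re]
  field_simp

end IsPositiveDefiniteOnReal

/-! ### Exponential moments from analytic characteristic functions -/

lemma AnalyticAt.isBigO_second_difference {F : ℂ → ℂ} (hF : AnalyticAt ℂ F 0) :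
    (fun z => F z + F (-z) - 2 * F 0) =O[𝓝 0] fun z => ‖z‖ ^ 2 := by
  obtain ⟨p, hp⟩ := hF
  have h := hp.isBigO_sub_partialSum_pow 2
  simp only [zero_add] at h
  have hneg : Tendsto (fun z : ℂ => -z) (𝓝 0) (𝓝 0) := by
    simpa using (continuous_neg (G := ℂ)).tendsto 0
  have h' := h.comp_tendsto hneg
  simp only [Function.comp_def, norm_neg] at h'
  refine (h.add h').congr_left fun z => ?_
  have h0 : p 0 (fun _ => z) = F 0 := hp.coeff_zero _
  have h0' : p 0 (fun _ => -z) = F 0 := hp.coeff_zero _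
  have h1 : p 1 (fun _ => -z) = - p 1 (fun _ => z) := by
    simp
  simp only [FormalMultilinearSeries.partialSum, Finset.sum_range_succ, Finset.sum_range_zero,
    h0, h0', h1]
  ring

namespace MeasureTheory

variable {ν : Measure ℝ} [IsFiniteMeasure ν] {F : ℂ → ℂ} {r : ℝ}

lemma charFun_second_difference (h : ℝ) :
    ((∫ t, (2 - 2 * Real.cos (h * t)) ∂ν : ℝ) : ℂ)
      = 2 * charFun ν 0 - charFun ν h - charFun ν (-h) := by
  have hI : ∀ x : ℝ, Integrable (fun t : ℝ => Complex.exp (x * t * Complex.I)) ν := fun x =>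
    Integrable.of_bound (by fun_prop) 1 (.of_forall fun t => by
      rw [← Complex.ofReal_mul, Complex.norm_exp_ofReal_mul_I])
  have hI2 : Integrable (fun t : ℝ => 2 * Complex.exp ((0 : ℝ) * t * Complex.I)
      - Complex.exp (h * t * Complex.I)) ν := ((hI 0).const_mul 2).sub (hI h)
  simp only [charFun_apply_real]
  rw [← integral_const_mul, ← integral_sub ((hI 0).const_mul 2) (hI h),
    ← integral_sub hI2 (hI (-h)), ← integral_complex_ofReal]
  refine integral_congr_ae (.of_forall fun t => ?_)
  push_cast
  rw [Complex.cos]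
  simp
  ring

/-- If the characteristic function extends analytically to a neighbourhood of the origin, the
second moment is finite. -/
lemma lintegral_sq_lt_top_of_charFun_eq (hF : AnalyticAt ℂ F 0) (hr : 0 < r)
    (hν : ∀ x : ℝ, |x| < r → charFun ν x = F x) :
    ∫⁻ t, ENNReal.ofReal (t ^ 2) ∂ν < ⊤ := by
  obtain ⟨C, hC⟩ := hF.isBigO_second_difference.bound
  set a : ℕ → ℝ := fun n => 1 / ((n : ℝ) + 1) with ha
  have hapos : ∀ n, 0 < a n := fun n => by positivity
  have ha0 : Tendsto a atTop (𝓝 0) := tendsto_one_div_add_atTop_nhds_zero_nat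
  have hbound : ∀ᶠ n in atTop,
      ∫⁻ t, ENNReal.ofReal ((2 - 2 * Real.cos (a n * t)) / a n ^ 2) ∂ν ≤ ENNReal.ofReal C := by
    have h1 : Tendsto (fun n => (a n : ℂ)) atTop (𝓝 0) := by
      simpa [Function.comp_def] using (Complex.continuous_ofReal.tendsto 0).comp ha0
    filter_upwards [h1.eventually hC, ha0.eventually_lt_const hr] with n hn hnr
    have hsd := charFun_second_difference (ν := ν) (a n)
    have habs : |a n| < r := by rwa [abs_of_pos (hapos n)]
    rw [hν _ habs, hν (-a n) (by rwa [abs_neg]), hν 0 (by simpa)] at hsd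
    have hnn : ∀ t, 0 ≤ 2 - 2 * Real.cos (a n * t) := fun t => by
      linarith [Real.cos_le_one (a n * t)]
    rw [← ofReal_integral_eq_lintegral_ofReal, integral_div]
    · apply ENNReal.ofReal_le_ofReal
      rw [div_le_iff₀ (by have := hapos n; positivity)]
      have h2 : ‖((∫ t, (2 - 2 * Real.cos (a n * t)) ∂ν : ℝ) : ℂ)‖
          = ‖F (a n) + F (-(a n)) - 2 * F 0‖ := by
        rw [hsd, ← norm_neg]; push_cast; congr 1; ring
      rw [Complex.norm_real, Real.norm_eq_abs, abs_of_nonneg (integral_nonneg hnn)] at h2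
      rw [h2]
      refine hn.trans_eq ?_
      simp
    · refine Integrable.of_bound (by fun_prop) (4 / a n ^ 2) (.of_forall fun t => ?_)
      rw [Real.norm_eq_abs, abs_of_nonneg (div_nonneg (hnn t) (by positivity))]
      gcongr
      linarith [Real.neg_one_le_cos (a n * t)]
    · exact .of_forall fun t => div_nonneg (hnn t) (by positivity)
  have hlim : ∀ t : ℝ, Tendsto (fun n => (2 - 2 * Real.cos (a n * t)) / a n ^ 2) atTop
      (𝓝 (t ^ 2)) := by
    intro t
    have e : ∀ n, (2 - 2 * Real.cos (a n * t)) / a n ^ 2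
        = (t * Real.sinc (a n * t / 2)) ^ 2 := fun n => by
      have hc : 2 - 2 * Real.cos (a n * t) = 4 * Real.sin (a n * t / 2) ^ 2 := by
        have := Real.cos_two_mul (a n * t / 2)
        have h3 := Real.sin_sq_add_cos_sq (a n * t / 2)
        rw [mul_div_cancel₀ _ two_ne_zero] at this
        rw [this]; linarith
      have := (hapos n).ne'
      by_cases ht : t = 0
      · simp [ht]
      rw [hc, Real.sinc_of_ne_zero (by positivity)]
      field_simp
      norm_num
    simp_rw [e]
    have h3 : Tendsto (fun n => a n * t / 2) atTop (𝓝 0) := by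
      simpa using (ha0.mul_const t).div_const 2
    have h4 := (Real.continuous_sinc.tendsto 0).comp h3
    simpa using (h4.const_mul t).pow 2
  -- Fatou's lemma: the second difference quotients are nonnegative and tend to t², and their
  -- integrals are eventually at most C.
  calc ∫⁻ t, ENNReal.ofReal (t ^ 2) ∂ν
      = ∫⁻ t, liminf (fun n => ENNReal.ofReal ((2 - 2 * Real.cos (a n * t)) / a n ^ 2)) atTop
          ∂ν := by
        refine lintegral_congr fun t => ?_
        exact ((ENNReal.continuous_ofReal.tendsto _).comp (hlim t)).liminf_eq.symm
    _ ≤ liminf (fun n => ∫⁻ t, ENNReal.ofReal ((2 - 2 * Real.cos (a n * t)) / a n ^ 2) ∂ν) atTop :=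
        lintegral_liminf_le fun n => by fun_prop
    _ ≤ ENNReal.ofReal C := liminf_le_of_frequently_le' hbound.frequently
    _ < ⊤ := ENNReal.ofReal_lt_top

/-- Two derivatives bring down (it)² = -t². Thus t²ν and -F'' satisfy the hypotheses imposed on ν
and F, on the same disc, which drives the induction on moments. -/
lemma charFun_withDensity_sq (hF : DifferentiableOn ℂ F (ball 0 r))
    (hν : ∀ x : ℝ, |x| < r → charFun ν x = F x)
    (h2 : ∫⁻ t, ENNReal.ofReal (t ^ 2) ∂ν < ⊤) {x : ℝ} (hx : |x| < r) :
    charFun (ν.withDensity fun t => ENNReal.ofReal (t ^ 2)) x = -deriv (deriv F) x := by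
  have hmem : MemLp id (2 : ℕ) ν := by
    rw [Nat.cast_ofNat, memLp_two_iff_integrable_sq (by fun_prop)]
    refine ⟨by fun_prop, ?_⟩
    rw [hasFiniteIntegral_iff_ofReal (.of_forall fun t => sq_nonneg _)]
    exact h2
  have hball : ∀ y : ℝ, |y| < r → (y : ℂ) ∈ ball (0 : ℂ) r := fun y hy => by simpa using hy
  have hev : ∀ y : ℝ, |y| < r → ∀ᶠ z in 𝓝 y, |z| < r := fun y hy =>
    (isOpen_lt continuous_abs continuous_const).mem_nhds hy
  have hd1 : ∀ y : ℝ, |y| < r → deriv (charFun ν) y = deriv F y := fun y hy => by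
    have : charFun ν =ᶠ[𝓝 y] fun z : ℝ => F z := (hev y hy).mono fun z hz => hν z hz
    rw [this.deriv_eq]
    exact ((hF.differentiableAt (isOpen_ball.mem_nhds (hball y hy))).hasDerivAt.comp_ofReal).deriv
  have hd2 : deriv (deriv (charFun ν)) x = deriv (deriv F) x := by
    have : deriv (charFun ν) =ᶠ[𝓝 x] fun z : ℝ => deriv F z :=
      (hev x hx).mono fun z hz => hd1 z hz
    rw [this.deriv_eq]
    exact (((hF.deriv isOpen_ball).differentiableAt
      (isOpen_ball.mem_nhds (hball x hx))).hasDerivAt.comp_ofReal).deriv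
  have h := iteratedDeriv_charFun (t := x) hmem
  rw [iteratedDeriv_succ, iteratedDeriv_one, hd2] at h
  rw [h, Complex.I_sq, neg_one_mul, neg_neg, charFun_apply_real,
    integral_withDensity_eq_integral_toReal_smul (by fun_prop)
      (.of_forall fun _ => ENNReal.ofReal_lt_top)]
  refine integral_congr_ae (.of_forall fun t => ?_)
  dsimp only
  rw [ENNReal.toReal_ofReal (sq_nonneg t), Complex.real_smul, Complex.ofReal_pow]

lemma lintegral_pow_eq_of_charFun_eq (n : ℕ) (ν : Measure ℝ) [IsFiniteMeasure ν] {F : ℂ → ℂ}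
    (hr : 0 < r) (hF : DifferentiableOn ℂ F (ball 0 r))
    (hν : ∀ x : ℝ, |x| < r → charFun ν x = F x) :
    ∫⁻ t, ENNReal.ofReal (t ^ (2 * n)) ∂ν = ENNReal.ofReal ‖iteratedDeriv (2 * n) F 0‖ := by
  induction n generalizing ν F with
  | zero =>
    have := hν 0 (by simpa)
    rw [charFun_zero] at this
    simp only [mul_zero, pow_zero, ENNReal.ofReal_one, lintegral_const, one_mul,
      iteratedDeriv_zero]
    rw [← Complex.ofReal_zero, ← this, Complex.norm_real, Real.norm_of_nonneg measureReal_nonneg,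
      ofReal_measureReal]
  | succ n ih =>
    have h2 := lintegral_sq_lt_top_of_charFun_eq
      (hF.analyticAt (isOpen_ball.mem_nhds (mem_ball_self hr))) hr hν
    have hfin : IsFiniteMeasure (ν.withDensity fun t => ENNReal.ofReal (t ^ 2)) :=
      isFiniteMeasure_withDensity h2.ne
    have := ih (ν.withDensity fun t => ENNReal.ofReal (t ^ 2)) (F := fun z => -deriv (deriv F) z)
      ((hF.deriv isOpen_ball).deriv isOpen_ball).neg
      (fun x hx => charFun_withDensity_sq hF hν h2 hx)
    rw [lintegral_withDensity_eq_lintegral_mul _ (by fun_prop) (by fun_prop)] at this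
    have e : 2 * (n + 1) = 2 * n + 1 + 1 := by ring
    rw [e, iteratedDeriv_succ', iteratedDeriv_succ']
    rw [iteratedDeriv_fun_neg, norm_neg] at this
    rw [← this]
    refine lintegral_congr fun t => ?_
    rw [Pi.mul_apply, ← ENNReal.ofReal_mul (sq_nonneg t)]
    congr 1
    ring

/-- A finite measure whose characteristic function extends holomorphically to a disc about the
origin has exponential moments up to the radius of the disc. -/
lemma integrable_exp_mul_of_charFun_eq (hF : DifferentiableOn ℂ F (ball 0 r))
    (hν : ∀ x : ℝ, |x| < r → charFun ν x = F x) {s : ℝ} (hs : |s| < r) :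
    Integrable (fun t => Real.exp (s * t)) ν := by
  -- Cauchy's estimates on the circle of radius R > |s| bound the terms by a geometric series of
  -- ratio (s/R)² < 1.
  obtain ⟨R, hsR, hRr⟩ := exists_between hs
  have hR : 0 < R := (abs_nonneg s).trans_lt hsR
  have hcl : closedBall (0 : ℂ) R ⊆ ball 0 r := closedBall_subset_ball hRr
  obtain ⟨M, hM⟩ := (isCompact_sphere (0 : ℂ) R).exists_bound_of_continuousOn
    (hF.continuousOn.mono (sphere_subset_closedBall.trans hcl))
  have hM0 : 0 ≤ M := (norm_nonneg _).trans (hM (R : ℂ) (by simp [abs_of_pos hR]))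
  have hdc : DiffContOnCl ℂ F (ball 0 R) :=
    (hF.mono (by rwa [closure_ball _ hR.ne'])).diffContOnCl
  have hterm : ∀ n : ℕ, ∫⁻ t, ENNReal.ofReal ((s * t) ^ (2 * n) / (2 * n).factorial) ∂ν
      ≤ ENNReal.ofReal (M * ((s / R) ^ 2) ^ n) := fun n => by
    have hsn : 0 ≤ s ^ (2 * n) / (2 * n).factorial := by
      rw [pow_mul]; positivity
    have e : ∀ t : ℝ, ENNReal.ofReal ((s * t) ^ (2 * n) / (2 * n).factorial)
        = ENNReal.ofReal (s ^ (2 * n) / (2 * n).factorial) * ENNReal.ofReal (t ^ (2 * n)) :=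
      fun t => by rw [← ENNReal.ofReal_mul hsn]; congr 1; ring
    simp_rw [e]
    rw [lintegral_const_mul _ (by fun_prop),
      lintegral_pow_eq_of_charFun_eq n ν ((abs_nonneg s).trans_lt hs) hF hν,
      ← ENNReal.ofReal_mul hsn]
    apply ENNReal.ofReal_le_ofReal
    have := Complex.norm_iteratedDeriv_le_of_forall_mem_sphere_norm_le (2 * n) hR hdc hM
    refine (mul_le_mul_of_nonneg_left this hsn).trans_eq ?_
    have : ((2 * n).factorial : ℝ) ≠ 0 := by positivity
    rw [← pow_mul, div_pow]
    field_simp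
  have hq : (s / R) ^ 2 < 1 := by
    rw [sq_lt_one_iff_abs_lt_one, abs_div, abs_of_pos hR, div_lt_one hR]
    exact hsR
  -- Only even moments are controlled, so cosh is summed first; its terms are nonnegative, and exp ≤
  -- 2 cosh.
  have hcosh : ∫⁻ t, ENNReal.ofReal (Real.cosh (s * t)) ∂ν < ⊤ := by
    have hnn : ∀ (t : ℝ) (n : ℕ), 0 ≤ (s * t) ^ (2 * n) / (2 * n).factorial := fun t n => by
      rw [pow_mul]; positivity
    calc ∫⁻ t, ENNReal.ofReal (Real.cosh (s * t)) ∂ν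
        = ∫⁻ t, ∑' n : ℕ, ENNReal.ofReal ((s * t) ^ (2 * n) / (2 * n).factorial) ∂ν := by
          refine lintegral_congr fun t => ?_
          rw [← ENNReal.ofReal_tsum_of_nonneg (hnn t) (Real.hasSum_cosh _).summable,
            (Real.hasSum_cosh _).tsum_eq]
      _ = ∑' n : ℕ, ∫⁻ t, ENNReal.ofReal ((s * t) ^ (2 * n) / (2 * n).factorial) ∂ν :=
          lintegral_tsum fun n => by fun_prop
      _ ≤ ∑' n : ℕ, ENNReal.ofReal (M * ((s / R) ^ 2) ^ n) := ENNReal.tsum_le_tsum hterm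
      _ = ENNReal.ofReal (∑' n : ℕ, M * ((s / R) ^ 2) ^ n) :=
          (ENNReal.ofReal_tsum_of_nonneg (fun n => by positivity)
            ((summable_geometric_of_lt_one (sq_nonneg _) hq).mul_left M)).symm
      _ < ⊤ := ENNReal.ofReal_lt_top
  have hc : Integrable (fun t => Real.cosh (s * t)) ν :=
    ⟨by fun_prop, (hasFiniteIntegral_iff_ofReal
      (.of_forall fun t => (Real.cosh_pos _).le)).2 hcosh⟩
  refine (hc.const_mul 2).mono' (by fun_prop) (.of_forall fun t => ?_)
  rw [Real.norm_eq_abs, Real.abs_exp, Real.cosh_eq]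
  linarith [Real.exp_pos (-(s * t))]

end MeasureTheory

/-! ### Identity theorem, exponential tilts and Fourier-Laplace transforms -/

lemma Complex.eqOn_of_eventually_eq_ofReal {F G : ℂ → ℂ} {U : Set ℂ} (hUo : IsOpen U)
    (hUc : IsPreconnected U) (h0 : 0 ∈ U) (hF : DifferentiableOn ℂ F U)
    (hG : DifferentiableOn ℂ G U) (h : ∀ᶠ x : ℝ in 𝓝 0, F x = G x) : Set.EqOn F G U := by
  refine (hF.analyticOnNhd hUo).eqOn_of_preconnected_of_frequently_eq (hG.analyticOnNhd hUo)
    hUc h0 ?_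
  have ht : Tendsto (fun x : ℝ => (x : ℂ)) (𝓝[≠] 0) (𝓝[≠] 0) := by
    refine tendsto_nhdsWithin_iff.2 ⟨?_, ?_⟩
    · have := Complex.continuous_ofReal.tendsto 0
      rw [Complex.ofReal_zero] at this
      exact this.mono_left nhdsWithin_le_nhds
    · filter_upwards [self_mem_nhdsWithin] with x hx
      simpa using hx
  exact ht.frequently (h.filter_mono nhdsWithin_le_nhds).frequently

lemma Complex.norm_exp_I_mul_mul_ofReal (z : ℂ) (t : ℝ) :
    ‖Complex.exp (Complex.I * z * t)‖ = Real.exp (-(z.im * t)) := by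
  rw [Complex.norm_exp]; simp

lemma integrable_exp_I_mul_iff {μ : Measure ℝ} {z : ℂ} :
    Integrable (fun t : ℝ => Complex.exp (Complex.I * z * t)) μ
      ↔ Integrable (fun t : ℝ => Real.exp (-(z.im * t))) μ := by
  rw [← integrable_norm_iff (by fun_prop)]
  simp_rw [Complex.norm_exp_I_mul_mul_ofReal]

/-- The measure `exp (-y t) dμ(t)`. -/
noncomputable def MeasureTheory.Measure.expWeight (μ : Measure ℝ) (y : ℝ) : Measure ℝ :=
  μ.withDensity fun t => ENNReal.ofReal (Real.exp (-(y * t)))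

namespace MeasureTheory.Measure

lemma expWeight_expWeight (μ : Measure ℝ) (x y : ℝ) :
    (μ.expWeight x).expWeight y = μ.expWeight (x + y) := by
  rw [expWeight, expWeight, ← withDensity_mul _ (by fun_prop) (by fun_prop), expWeight]
  congr 1
  ext t
  rw [Pi.mul_apply, ← ENNReal.ofReal_mul (Real.exp_pos _).le, ← Real.exp_add]
  congr 2
  ring

lemma expWeight_zero (μ : Measure ℝ) : μ.expWeight 0 = μ := by
  simp [expWeight]

lemma isFiniteMeasure_expWeight {μ : Measure ℝ} {y : ℝ}
    (h : Integrable (fun t => Real.exp (-(y * t))) μ) : IsFiniteMeasure (μ.expWeight y) :=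
  isFiniteMeasure_withDensity_ofReal h.2

lemma lintegral_exp_eq_expWeight_univ (μ : Measure ℝ) (y : ℝ) :
    ∫⁻ t, ENNReal.ofReal (Real.exp (-(y * t))) ∂μ = μ.expWeight y Set.univ := by
  rw [expWeight, withDensity_apply _ MeasurableSet.univ, setLIntegral_univ]

lemma integrable_exp_of_lintegral_lt_top {μ : Measure ℝ} {y : ℝ}
    (h : ∫⁻ t, ENNReal.ofReal (Real.exp (-(y * t))) ∂μ < ⊤) :
    Integrable (fun t => Real.exp (-(y * t))) μ :=
  ⟨by fun_prop, (hasFiniteIntegral_iff_ofReal (.of_forall fun _ => (Real.exp_pos _).le)).2 h⟩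

/-- Tilting by y moves the transform from the real line to the line of height y; this links
Bochner's theorem to the strip. -/
lemma charFun_expWeight (μ : Measure ℝ) (y x : ℝ) :
    charFun (μ.expWeight y) x
      = ∫ t : ℝ, Complex.exp (Complex.I * (x + y * Complex.I) * t) ∂μ := by
  rw [charFun_apply_real, expWeight, integral_withDensity_eq_integral_toReal_smul (by fun_prop)
    (.of_forall fun _ => ENNReal.ofReal_lt_top)]
  refine integral_congr_ae (.of_forall fun t => ?_)
  dsimp only
  rw [ENNReal.toReal_ofReal (Real.exp_pos _).le, Complex.real_smul, Complex.ofReal_exp,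
    ← Complex.exp_add]
  congr 1
  push_cast
  linear_combination (-(y * t) : ℂ) * Complex.I_sq

end MeasureTheory.Measure

/-- The Fourier-Laplace transform is holomorphic in the strip over an open set of exponents. -/
lemma differentiableOn_integral_exp_I_mul {μ : Measure ℝ} {J : Set ℝ} (hJ : IsOpen J)
    (h : ∀ y ∈ J, Integrable (fun t => Real.exp (-(y * t))) μ) :
    DifferentiableOn ℂ (fun z => ∫ t : ℝ, Complex.exp (Complex.I * z * t) ∂μ)
      {z | z.im ∈ J} := by
  have hmaps : Set.MapsTo (fun z : ℂ => Complex.I * z) {z | z.im ∈ J}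
      {z | z.re ∈ interior (integrableExpSet id μ)} := by
    intro z hz
    -- The sign changes because `integrableExpSet` refers to exp(st), not exp(-st).
    have hsub : -J ⊆ integrableExpSet id μ := fun s hs => by
      simpa [integrableExpSet] using h (-s) hs
    have : -z.im ∈ interior (integrableExpSet id μ) :=
      interior_maximal hsub hJ.neg (by simpa using hz)
    simpa using this
  exact (differentiableOn_complexMGF (X := id) (μ := μ)).comp (by fun_prop) hmaps

/-! ### Gluing the measures of the horizontal lines -/

lemma isOpen_realInterval (a b : EReal) : IsOpen (realInterval a b) :=
  (isOpen_lt continuous_const continuous_coe_real_ereal).inter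
    (isOpen_lt continuous_coe_real_ereal continuous_const)

lemma isPreconnected_realInterval (a b : EReal) : IsPreconnected (realInterval a b) :=
  Set.OrdConnected.isPreconnected ⟨fun _ hx _ hy _ hz =>
    ⟨hx.1.trans_le (by exact_mod_cast hz.1), lt_of_le_of_lt (by exact_mod_cast hz.2) hy.2⟩⟩

lemma realInterval_nonempty {a b : EReal} (hab : a < b) : (realInterval a b).Nonempty := by
  obtain ⟨y, h1, h2⟩ := EReal.lt_iff_exists_real_btwn.1 hab
  exact ⟨y, h1, h2⟩

lemma IsPositiveDefiniteIn.restrict_horizontal_line {a b : EReal} {f : ℂ → ℂ}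
    (hf : IsPositiveDefiniteIn f (horizontalStrip a b)) {y : ℝ} (hy : y ∈ realInterval a b) :
    IsPositiveDefiniteOnReal fun x : ℝ => f (x + y * Complex.I) := by
  intro n x ξ
  -- Points at height y/2 have codifferences at height y.
  have e : ∀ k l, (x k + (y / 2 : ℝ) * Complex.I : ℂ) - conj (x l + (y / 2 : ℝ) * Complex.I : ℂ)
      = (x k - x l : ℝ) + y * Complex.I := fun k l => by
    simp only [map_add, map_mul, Complex.conj_ofReal, Complex.conj_I]
    push_cast
    ring
  have h := hf n (fun k => x k + (y / 2 : ℝ) * Complex.I)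
    (fun k l => by rw [e]; simpa [horizontalStrip, realInterval] using hy) ξ
  simpa only [e] using h

/-- If the Fourier-Laplace transforms of two measures on neighbouring horizontal lines are given by
one holomorphic function, then the measures are exponential tilts of each other. -/
lemma expWeight_eq_of_charFun_eq {f : ℂ → ℂ} {y y' r r' : ℝ} {ν ν' : Measure ℝ}
    [IsFiniteMeasure ν] [IsFiniteMeasure ν']
    (hd : DifferentiableOn ℂ f (ball (y * Complex.I) r))
    (hd' : DifferentiableOn ℂ f (ball (y' * Complex.I) r'))
    (hν : ∀ x : ℝ, charFun ν x = f (x + y * Complex.I))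
    (hν' : ∀ x : ℝ, charFun ν' x = f (x + y' * Complex.I))
    (hr' : 0 < r') (hyy : |y' - y| < r) :
    ν.expWeight (y' - y) = ν' := by
  have hshift : ∀ (c : ℂ) (s : ℝ), DifferentiableOn ℂ f (ball c s) →
      DifferentiableOn ℂ (fun z => f (z + c)) (ball 0 s) := fun c s h =>
    h.comp (by fun_prop) fun z hz => by simpa [dist_eq_norm] using hz
  have hI : ∀ s ∈ Set.Ioo (-r) r, Integrable (fun t => Real.exp (-(s * t))) ν := fun s hs => by
    simpa using integrable_exp_mul_of_charFun_eq (hshift _ _ hd) (fun x _ => hν x) (s := -s)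
      (by rw [abs_neg, abs_lt]; exact hs)
  have hI' : ∀ s ∈ Set.Ioo (-r') r', Integrable (fun t => Real.exp (-(s * t))) ν' :=
    fun s hs => by
      simpa using integrable_exp_mul_of_charFun_eq (hshift _ _ hd') (fun x _ => hν' x) (s := -s)
        (by rw [abs_neg, abs_lt]; exact hs)
  set G : ℂ → ℂ := fun z => ∫ t : ℝ, Complex.exp (Complex.I * z * t) ∂ν with hG
  set G' : ℂ → ℂ := fun z => ∫ t : ℝ, Complex.exp (Complex.I * z * t) ∂ν' with hG'
  have hGd : DifferentiableOn ℂ G {z | z.im ∈ Set.Ioo (-r) r} :=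
    differentiableOn_integral_exp_I_mul isOpen_Ioo hI
  have hGd' : DifferentiableOn ℂ G' {z | z.im ∈ Set.Ioo (-r') r'} :=
    differentiableOn_integral_exp_I_mul isOpen_Ioo hI'
  have hGr : ∀ x : ℝ, G x = charFun ν x := fun x => by
    rw [charFun_apply_real, hG]
    refine integral_congr_ae (.of_forall fun t => ?_)
    ring_nf
  have hGr' : ∀ x : ℝ, G' x = charFun ν' x := fun x => by
    rw [charFun_apply_real, hG']
    refine integral_congr_ae (.of_forall fun t => ?_)
    ring_nf
  have hr : 0 < r := (abs_nonneg _).trans_lt hyy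
  have hball : Set.EqOn (fun z => f (z + y * Complex.I)) G (ball 0 r) := by
    refine Complex.eqOn_of_eventually_eq_ofReal isOpen_ball (convex_ball _ _).isPreconnected
      (mem_ball_self hr) (hshift _ _ hd) (hGd.mono fun z hz => ?_)
      (.of_forall fun x => by rw [hGr, hν])
    rw [mem_ball_zero_iff] at hz
    exact abs_lt.1 ((Complex.abs_im_le_norm z).trans_lt hz)
  set η := y' - y with hη
  -- In a strip of this half-width, z + iη stays where G is holomorphic and z where G' is.
  have hδ : 0 < min (r - |η|) r' := lt_min (sub_pos.2 hyy) hr'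
  have hηI : η ∈ Set.Ioo (-r) r := abs_lt.1 hyy
  have hstrip : Set.EqOn (fun z => G (z + η * Complex.I)) G'
      {z | z.im ∈ Set.Ioo (-min (r - |η|) r') (min (r - |η|) r')} := by
    refine Complex.eqOn_of_eventually_eq_ofReal (isOpen_Ioo.preimage Complex.continuous_im)
      ((convex_Ioo _ _).linear_preimage Complex.imLm).isPreconnected (by simpa using hδ)
      (hGd.comp (by fun_prop) fun z hz => ?_)
      (hGd'.mono fun z hz => ?_) ?_
    · have h1 : |z.im| < r - |η| := (abs_lt.2 hz).trans_le (min_le_left _ _)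
      have h2 : |z.im + η| < r := (abs_add_le _ _).trans_lt (by linarith)
      simpa using abs_lt.1 h2
    · exact abs_lt.1 ((abs_lt.2 hz).trans_le (min_le_right _ _))
    · have hc : Continuous fun x : ℝ => ‖(x : ℂ) + η * Complex.I‖ := by fun_prop
      have h0 : ‖((0 : ℝ) : ℂ) + η * Complex.I‖ < r := by simpa using hyy
      filter_upwards [hc.continuousAt.eventually_lt continuousAt_const h0] with x hx
      rw [hGr', hν', ← hball (by simpa using hx)]
      simp only [hη]
      congr 1
      push_cast
      ring
  have hfin : IsFiniteMeasure (ν.expWeight η) := Measure.isFiniteMeasure_expWeight (hI η hηI)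
  refine Measure.ext_of_charFun (funext fun x => ?_)
  rw [Measure.charFun_expWeight, ← hGr', ← hstrip (by simpa using hδ)]

/-- A positive definite function in a strip that is holomorphic near the imaginary segment has a
common representing measure on all horizontal lines. -/
lemma exists_measure_charFun_expWeight_eq {a b : EReal} (hab : a < b) {f : ℂ → ℂ}
    (hf : IsPositiveDefiniteIn f (horizontalStrip a b)) {Ω : Set ℂ} (hΩ : IsOpen Ω)
    (hseg : imaginarySegment a b ⊆ Ω) (hol : DifferentiableOn ℂ f Ω) :
    ∃ μ : Measure ℝ, ∀ y ∈ realInterval a b, IsFiniteMeasure (μ.expWeight y) ∧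
      ∀ x : ℝ, charFun (μ.expWeight y) x = f (x + y * Complex.I) := by
  have hmem : ∀ y ∈ realInterval a b, (y * Complex.I : ℂ) ∈ Ω := fun y hy =>
    hseg ⟨y, hy, mul_comm _ _⟩
  have hbochner : ∀ y : realInterval a b, ∃ ν : Measure ℝ, IsFiniteMeasure ν ∧
      ∀ x, charFun ν x = f (x + (y : ℝ) * Complex.I) := fun y => by
    refine (hf.restrict_horizontal_line y.2).exists_charFun_eq ?_
    have h1 : ContinuousAt f (((0 : ℝ) : ℂ) + (y : ℝ) * Complex.I) := by
      rw [Complex.ofReal_zero, zero_add]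
      exact (hol.differentiableAt (hΩ.mem_nhds (hmem y y.2))).continuousAt
    exact ContinuousAt.comp (f := fun x : ℝ => (x + (y : ℝ) * Complex.I : ℂ)) h1 (by fun_prop)
  choose ν hfin hν using hbochner
  have hrad : ∀ y : realInterval a b, ∃ r > 0, ball ((y : ℝ) * Complex.I : ℂ) r ⊆ Ω := fun y =>
    Metric.isOpen_iff.1 hΩ _ (hmem y y.2)
  choose r hr hrΩ using hrad
  have hconst : IsLocallyConstant fun y : realInterval a b => (ν y).expWeight (-y) := by
    refine (IsLocallyConstant.iff_eventually_eq _).2 fun y => ?_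
    -- Only the disc about iy has to reach iy'; the other may be arbitrarily small, so the radii
    -- need no uniform lower bound.
    filter_upwards [Metric.ball_mem_nhds y (hr y)] with y' hy'
    rw [← expWeight_eq_of_charFun_eq (hol.mono (hrΩ y)) (hol.mono (hrΩ y')) (hν y) (hν y') (hr y')
      hy', Measure.expWeight_expWeight]
    congr 1
    ring
  have : PreconnectedSpace (realInterval a b) :=
    Subtype.preconnectedSpace (isPreconnected_realInterval a b)
  obtain ⟨y₀, hy₀⟩ := realInterval_nonempty hab
  refine ⟨(ν ⟨y₀, hy₀⟩).expWeight (-y₀), fun y hy => ?_⟩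
  have h1 : (ν ⟨y₀, hy₀⟩).expWeight (-y₀) = (ν ⟨y, hy⟩).expWeight (-y) :=
    hconst.apply_eq_of_preconnectedSpace ⟨y₀, hy₀⟩ ⟨y, hy⟩
  rw [h1, Measure.expWeight_expWeight, neg_add_cancel, Measure.expWeight_zero]
  exact ⟨hfin _, hν _⟩

theorem mainTheorem5 (a b : EReal) (hab : a < b) (f : ℂ → ℂ)
    (hf : IsPositiveDefiniteIn f (horizontalStrip a b))
    (Ω : Set ℂ) (hΩ : IsOpen Ω) (hΩS : Ω ⊆ horizontalStrip a b)
    (hseg : imaginarySegment a b ⊆ Ω) (hol : DifferentiableOn ℂ f Ω) :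
    DifferentiableOn ℂ f (horizontalStrip a b) ∧
      ∃! μ : Measure ℝ, IsExponentiallyFinite μ (realInterval a b) ∧
        IsFourierLaplaceTransformOn f μ (horizontalStrip a b) := by
  obtain ⟨μ, hμ⟩ := exists_measure_charFun_expWeight_eq hab hf hΩ hseg hol
  have hexp : IsExponentiallyFinite μ (realInterval a b) := fun y hy => by
    rw [Measure.lintegral_exp_eq_expWeight_univ]
    exact (hμ y hy).1.measure_univ_lt_top
  have hint : ∀ y ∈ realInterval a b, Integrable (fun t => Real.exp (-(y * t))) μ := fun y hy =>
    Measure.integrable_exp_of_lintegral_lt_top (hexp y hy)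
  have htrans : IsFourierLaplaceTransformOn f μ (horizontalStrip a b) := fun z hz => by
    refine ⟨integrable_exp_I_mul_iff.2 (hint z.im hz), ?_⟩
    have := (hμ z.im hz).2 z.re
    rw [Measure.charFun_expWeight, Complex.re_add_im] at this
    exact this.symm
  refine ⟨(differentiableOn_integral_exp_I_mul (isOpen_realInterval a b) hint).congr
    fun z hz => (htrans z hz).2, μ, ⟨hexp, htrans⟩, fun μ' hμ' => ?_⟩
  -- One height suffices for uniqueness, since tilting by y is undone by tilting by -y.
  obtain ⟨y, hy⟩ := realInterval_nonempty hab
  have hfin := (hμ y hy).1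
  have hfin' : IsFiniteMeasure (μ'.expWeight y) :=
    Measure.isFiniteMeasure_expWeight (Measure.integrable_exp_of_lintegral_lt_top (hμ'.1 y hy))
  have heq : μ'.expWeight y = μ.expWeight y := by
    refine Measure.ext_of_charFun (funext fun x => ?_)
    rw [(hμ y hy).2, Measure.charFun_expWeight]
    exact (hμ'.2 (x + y * Complex.I) (by simpa [horizontalStrip, realInterval] using hy)).2.symm
  have h := congrArg (fun κ : Measure ℝ => κ.expWeight (-y)) heq
  simpa only [Measure.expWeight_expWeight, add_neg_cancel, Measure.expWeight_zero] using h
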